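/- **Setting.** $\lambda$ is the security parameter. A function $\nu(\lambda)$ is negligible if $\lambda^e\nu(\lambda)\to 0$ for every $e\in\mathbb N$. A QPT adversary is a family (one member for each $\lambda$) of quantum circuits over Hadamard, $T$ and CNOT gates, with auxiliary qubits in state $|0\rangle$ and measurements in the computational basis, whose total size is polynomially bounded in $\lambda$ (the usual non-uniform circuit model). A *secret key single-decryptor encryption (SDE) scheme* with plaintext space $\mathcal M=\mathcal M_\lambda$ (a set of bit strings of a length depending on $\lambda$) consists of: key generation $\mathcal{KG}(1^\lambda)\to(\mathsf{ek},d)$, with a classical encryption key $\mathsf{ek}$ and a quantum decryption key $d$, jointly in a classical-quantum state; a randomised encryption $\mathsf{Enc}(\mathsf{ek},m)\to\mathsf{ct}$ with classical ciphertexts; and a quantum decryption $\mathcal{D}ec(d,\mathsf{ct})\to m'\in\mathcal M\cup\{\bot\}$; such that, for some negligible $\nu$ and all $m\in\mathcal M$, decrypting a fresh encryption of $m$ returns $m$ with probability at least $1-\nu(\lambda)$. A *quantum program* $D=(\rho,U)$ is a quantum state $\rho$ together with a classical description $U$ of unitaries $(U_{\mathsf{ct}})_{\mathsf{ct}}$,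 given by one circuit that may read $\mathsf{ct}$; running $D$ on $\mathsf{ct}$ means applying $U_{\mathsf{ct}}$ to $\rho$ and measuring a designated output qubit. For a binary POVM $(P,I-P)$, the measurement $\mathsf{ProjImp}(P)$ (the projective implementation) is the projective measurement onto the eigenspaces of $P$, with the eigenvalue $p\in[0,1]$ as outcome. *One-time strong anti-piracy.* For an adversary $\mathcal A=(\mathcal A_0,\mathcal A_1,\mathcal A_2)$ and $\gamma\in[0,1]$: (1) the challenger samples $(\mathsf{ek},d)\leftarrow\mathcal{KG}(1^\lambda)$ and gives $d$ to $\mathcal A_0$; (2) $\mathcal A_0$ outputs $m_0,m_1\in\mathcal M$ and a bipartite state over registers $R_1,R_2$, and sends $R_i$ to $\mathcal A_i$; (3) $\mathcal A_i$ outputs a program $D_i=(\rho[R_i],U_i)$ for $i=1,2$; (4) for $i=1,2$ put $P_i=\sum_{b,\mathsf{ct}}\tfrac12\Pr[\mathsf{Enc}(\mathsf{ek},m_b)=\mathsf{ct}]\;U_{i,\mathsf{ct}}^\dagger|b\rangle\langle b|U_{i,\mathsf{ct}}$; the challenger applies $\mathsf{ProjImp}(P_i)$ to $\rho[R_i]$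 and obtains $p_i$. The output is $1$ if and only if $p_1>\frac12+\gamma$ and $p_2>\frac12+\gamma$. The scheme is *one-time strong anti-piracy secure* if for every $\gamma=\gamma(\lambda)\in[0,1]$ with $\gamma(\lambda)\ge\lambda^{-e}$ for some $e\in\mathbb N$ and all large $\lambda$, and every QPT adversary $\mathcal A$, the probability of output $1$ is negligible in $\lambda$. *One-out-of-many one-time anti-piracy.* For $n\ge 2$ and an adversary $\mathcal A=(\mathcal A_0,\mathcal A_1,\dots,\mathcal A_n)$: (1) the challenger samples $(\mathsf{ek},d)\leftarrow\mathcal{KG}(1^\lambda)$ and gives $d$ to $\mathcal A_0$; (2) $\mathcal A_0$ outputs $m_0,m_1\in\mathcal M$ and a state over registers $R_1,\dots,R_n$, and sends $R_i$ to $\mathcal A_i$; (3) each $\mathcal A_i$ outputs a program $D_i=(\rho[R_i],U_i)$; (4) the challenger picks $\alpha\in\{1,\dots,n\}$ and $\mathsf{coin}\in\{0,1\}$ uniformly, samples $\mathsf{ct}\leftarrow\mathsf{Enc}(\mathsf{ek},m_{\mathsf{coin}})$ and runs $D_\alpha$ on $\mathsf{ct}$. The output is $1$ if and only if $D_\alpha$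 outputs $\mathsf{coin}$. The scheme is *one-out-of-many one-time anti-piracy secure* if for every polynomially bounded $n=n(\lambda)\ge 2$ and every QPT adversary $\mathcal A=(\mathcal A_0,\dots,\mathcal A_n)$ there is a negligible $\nu$ such that, for every $\lambda$, the probability of output $1$ is at most $\frac12+\frac1{2n(\lambda)}+\nu(\lambda)$. **Theorem.** If a secret key SDE scheme is one-time strong anti-piracy secure, then it is one-out-of-many one-time anti-piracy secure. -/

import Mathlib

open scoped Matrix ComplexOrder

namespace SDE

/-! ### Qubits, gates and measurements -/

/-- Bit strings of length `k`. -/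
abbrev Bits (k : ℕ) : Type := Fin k → Bool

/-- Operators on the Hilbert space of the qubits (wires) `W`; the computational basis consists of
the assignments `W → Bool`. -/
abbrev Op (W : Type) : Type := Matrix (W → Bool) (W → Bool) ℂ

/-- The gates of a quantum circuit on the wires `W` which may also read a classical input of
`c` bits: Hadamard, the `π/8` gate, `CNOT`, and a bit flip on a wire that is applied if and only if
a given bit of the classical input is `1`. -/
inductive Gate (W : Type) (c : ℕ) : Type
  | had (w : W) : Gate W c
  | tee (w : W) : Gate W c
  | cnot (control target : W) (ne : control ≠ target) : Gate W c
  | flip (j : Fin c) (target : W) : Gate W c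

/-- The gate touches only wires of `R`. -/
def Gate.ActsOn {W : Type} {c : ℕ} (R : Set W) : Gate W c → Prop
  | .had w => w ∈ R
  | .tee w => w ∈ R
  | .cnot v w _ => v ∈ R ∧ w ∈ R
  | .flip _ w => w ∈ R

noncomputable section

section Wires

variable {W : Type} [Fintype W] [DecidableEq W] {c : ℕ}

/-- The unitary of a gate, given the classical input `z`. -/
def Gate.mat (z : Bits c) : Gate W c → Op W
  | .had w => fun x y =>
      if ∀ v, v ≠ w → x v = y v then
        (if x w = true ∧ y w = true then -1 else 1) / ((Real.sqrt 2 : ℝ) : ℂ)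
      else 0
  | .tee w => Matrix.diagonal fun x =>
      if x w = true then Complex.exp (Complex.I * (Real.pi / 4)) else 1
  | .cnot v w _ => fun x y => if x = Function.update y w (xor (y w) (y v)) then 1 else 0
  | .flip j w => fun x y => if x = Function.update y w (xor (y w) (z j)) then 1 else 0

/-- The unitary of a circuit (a list of gates, applied from left to right), given the classical
input `z`. -/
def circuitMat (z : Bits c) : List (Gate W c) → Op W
  | [] => 1
  | g :: gs => circuitMat z gs * g.mat z

/-- The projector of the outcome `b` when the wires `v 0, v 1, …` are measured in the computational
basis. -/
def measProj {k : ℕ} (v : Fin k → W) (b : Bits k) : Op W :=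
  Matrix.diagonal fun x => if ∀ j, x (v j) = b j then 1 else 0

/-- `|b⟩⟨b|` on the wire `w`, tensored with the identity on all other wires. -/
def bitProj (w : W) (b : Bool) : Op W :=
  Matrix.diagonal fun x => if x w = b then 1 else 0

/-- The probability with which the (subnormalised) state `ρ` passes the operation with Kraus
operator `K`. -/
def prob (K ρ : Op W) : ℝ := (K * ρ * Kᴴ).trace.re

/-! ### Projective implementations -/

/-- A projective measurement with projectors `E p`, `p ∈ V`, the index `p` standing for the
distribution on `{0, 1}` with `Pr[1] = p`, is a projective implementation of the binary POVM
`(P, 1 - P)`: measuring `p` and then outputting `1` with probability `p` is the same as measuring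
`(P, 1 - P)`. -/
structure IsProjImp (P : Op W) (V : Finset ℝ) (E : ℝ → Op W) : Prop where
  mem_unit : ∀ p ∈ V, 0 ≤ p ∧ p ≤ 1
  hermitian : ∀ p ∈ V, (E p).IsHermitian
  idem : ∀ p ∈ V, E p * E p = E p
  orthogonal : ∀ p ∈ V, ∀ q ∈ V, p ≠ q → E p * E q = 0
  sum_eq_one : ∑ p ∈ V, E p = 1
  implements : ∑ p ∈ V, (p : ℂ) • E p = P

/-- The possible outcomes of `ProjImp (P, 1 - P)`: the eigenvalues of `P`. -/
def outcomes (P : Op W) : Finset ℝ := (Matrix.finite_real_spectrum (A := P)).toFinset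

/-- The projector of `ProjImp (P, 1 - P)` for the outcome `p`: the orthogonal projector onto the
eigenspace of `P` for the eigenvalue `p`. -/
def projImp (P : Op W) (p : ℝ) : Op W := cfc (fun x : ℝ => if x = p then (1 : ℝ) else 0) P

open scoped MatrixOrder in
/-- `outcomes P` and `projImp P` do form a projective implementation of `(P, 1 - P)`. -/
theorem isProjImp_projImp (P : Op W) (h0 : P.PosSemidef) (h1 : (1 - P).PosSemidef) :
    IsProjImp P (outcomes P) (projImp P) := by
  have hsa : IsSelfAdjoint P := h0.1
  have hfin : (spectrum ℝ P).Finite := Matrix.finite_real_spectrum (A := P)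
  have hc : ∀ f : ℝ → ℝ, ContinuousOn f (spectrum ℝ P) := fun f => hfin.continuousOn f
  have hmem : ∀ p, p ∈ outcomes P ↔ p ∈ spectrum ℝ P := fun p => by simp [outcomes]
  refine ⟨?_, ?_, ?_, ?_, ?_, ?_⟩
  · intro p hp
    rw [hmem] at hp
    constructor
    · exact spectrum_nonneg_of_nonneg (Matrix.nonneg_iff_posSemidef.2 h0) hp
    · have h2 : (1 - p) ∈ spectrum ℝ (1 - P) := by
        have h3 := spectrum.singleton_sub_eq (R := ℝ) P 1
        rw [map_one] at h3
        rw [← h3]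
        exact Set.sub_mem_sub rfl hp
      have h4 := spectrum_nonneg_of_nonneg (Matrix.nonneg_iff_posSemidef.2 h1) h2
      linarith
  · intro p _
    exact cfc_predicate (R := ℝ) _ P
  · intro p _
    rw [projImp, ← cfc_mul _ _ P (hc _) (hc _)]
    congr 1; ext x; simp
  · intro p _ q _ hpq
    rw [projImp, projImp, ← cfc_mul _ _ P (hc _) (hc _), ← cfc_zero ℝ P]
    congr 1; ext x; simp; grind
  · have h2 := cfc_sum (fun p : ℝ => fun x : ℝ => if x = p then (1 : ℝ) else 0) P (outcomes P)
      (fun p _ => hc _)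
    simp only [projImp]
    rw [← h2, ← cfc_one ℝ P]
    apply cfc_congr
    intro x hx
    simp [hmem, hx]
  · have h2 := cfc_sum (fun p : ℝ => fun x : ℝ => if x = p then p else 0) P (outcomes P)
      (fun p _ => hc _)
    have h3 : ∀ p : ℝ, (p : ℂ) • projImp P p = cfc (fun x : ℝ => if x = p then p else 0) P := by
      intro p
      rw [projImp, Complex.coe_smul, ← cfc_smul p _ P (hc _)]
      congr 1; ext x; simp
    simp only [h3]
    rw [← h2]
    conv_rhs => rw [← cfc_id ℝ P]
    apply cfc_congr
    intro x hx
    simp [hmem, hx]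

end Wires

/-! ### Asymptotics -/

/-- `ν` vanishes faster than every inverse polynomial. -/
def Negligible (ν : ℕ → ℝ) : Prop :=
  Asymptotics.SuperpolynomialDecay Filter.atTop (fun k : ℕ => (k : ℝ)) ν

def PolyBounded (f : ℕ → ℕ) : Prop := ∃ p : Polynomial ℕ, ∀ k, f k ≤ p.eval k

/-- `γ` takes values in `[0, 1]` and is eventually at least some inverse polynomial. -/
def InversePoly (γ : ℕ → ℝ) : Prop :=
  (∀ k, 0 ≤ γ k ∧ γ k ≤ 1) ∧ ∃ e : ℕ, ∀ᶠ k : ℕ in Filter.atTop, ((k : ℝ) ^ e)⁻¹ ≤ γ k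

/-! ### Single-decryptor encryption -/

/-- A secret key single-decryptor encryption scheme; `k` is the security parameter. -/
structure Scheme where
  ekLen : ℕ → ℕ
  dkLen : ℕ → ℕ
  msgLen : ℕ → ℕ
  ctLen : ℕ → ℕ
  /-- The plaintext space. -/
  space : ∀ k, Finset (Bits (msgLen k))
  /-- Key generation: the classical-quantum state `∑ ek, |ek⟩⟨ek| ⊗ kg k ek` of a classical
  encryption key and a quantum decryption key of `dkLen k` qubits. -/
  kg : ∀ k, Bits (ekLen k) → Op (Fin (dkLen k))
  kg_pos : ∀ k ek, (kg k ek).PosSemidef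
  kg_trace : ∀ k, ∑ ek, (kg k ek).trace = 1
  /-- Randomised classical encryption. -/
  enc : ∀ k, Bits (ekLen k) → space k → PMF (Bits (ctLen k))
  /-- Decryption of a ciphertext: a measurement of the decryption key; `none` stands for `⊥`. -/
  dec : ∀ k, Bits (ctLen k) → Option (space k) → Op (Fin (dkLen k))
  dec_pos : ∀ k ct m, (dec k ct m).PosSemidef
  dec_sum : ∀ k ct, ∑ m, dec k ct m = 1
  /-- Decryption correctness. -/
  correct : ∃ ν : ℕ → ℝ, Negligible ν ∧ ∀ k (m : space k),
    1 - ν k ≤ ∑ ek, ∑ ct, (enc k ek m ct).toReal * (dec k ct (some m) * kg k ek).trace.re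

/-! ### Adversaries -/

/-- A second-stage adversary `A_i`, which outputs a quantum program `(ρ, U)` with classical input
and output. It applies the circuit `circ` and then measures the wires `sel j`. The outcome
`u` determines the classical description of `U` that is output: `U` is the circuit which
consists of those gates `slot j`, in order, with `u j = 1`; these may read the ciphertext.
The program is run on the wires left by `A_i`, and its output is read off the wire `out`. -/
structure Pirate (W : Type) (c : ℕ) where
  circ : List (Gate W 0)
  slots : ℕ
  sel : Fin slots → W
  slot : Fin slots → Gate W c
  out : W

namespace Pirate

variable {W : Type} {c : ℕ}

/-- The adversary touches only the register `R`. -/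
def ActsOn (R : Set W) (B : Pirate W c) : Prop :=
  (∀ g ∈ B.circ, g.ActsOn R) ∧ (∀ j, B.sel j ∈ R) ∧ (∀ j, (B.slot j).ActsOn R) ∧ B.out ∈ R

def size (B : Pirate W c) : ℕ := B.circ.length + B.slots

variable [Fintype W] [DecidableEq W]

/-- The Kraus operator with which `A_i` acts when its measurement has the outcome `u`. -/
def kraus (B : Pirate W c) (u : Bits B.slots) : Op W :=
  measProj B.sel u * circuitMat (fun j => j.elim0) B.circ

/-- The unitary `U_ct` of the quantum program with the description given by `u`. -/
def unitary (B : Pirate W c) (u : Bits B.slots) (ct : Bits c) : Op W :=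
  circuitMat ct (((List.finRange B.slots).filter fun j => u j).map B.slot)

/-- `P_{b,ct} = U_ct† |b⟩⟨b| U_ct`. -/
def proj (B : Pirate W c) (u : Bits B.slots) (b : Bool) (ct : Bits c) : Op W :=
  (B.unitary u ct)ᴴ * bitProj B.out b * B.unitary u ct

/-- `P_D = ∑ Pr[(b, ct) ← D] P_{b,ct}`, where `D` picks a uniform bit `b` and then a ciphertext
`ct ← enc b`. -/
def mixture (B : Pirate W c) (u : Bits B.slots) (enc : Bool → PMF (Bits c)) : Op W :=
  ∑ b, ∑ ct, ((1 / 2 * (enc b ct).toReal : ℝ) : ℂ) • B.proj u b ct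

end Pirate

/-- A tuple `(A_0, A_1, …, A_n)` of adversaries for one value of the security parameter: `d` is
the number of qubits of the decryption key, `m` the length of plaintexts and `c` that of
ciphertexts. `A_0` applies the circuit `split` to the decryption key and `anc` further qubits in
state `|0⟩`, measures the wires `msg false` and `msg true` to obtain the plaintexts `m_0` and
`m_1`, and sends to `A_i` the register of all wires `w` with `recipient w = some i` (and discards
those with `recipient w = none`). -/
structure Adversary (d m c n : ℕ) where
  anc : ℕ
  split : List (Gate (Fin d ⊕ Fin anc) 0)
  msg : Bool → Fin m → Fin d ⊕ Fin anc
  recipient : Fin d ⊕ Fin anc → Option (Fin n)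
  pirate : Fin n → Pirate (Fin d ⊕ Fin anc) c
  isLocal : ∀ i, (pirate i).ActsOn {w | recipient w = some i}

namespace Adversary

variable {d m c n : ℕ}

/-- The number of gates and auxiliary qubits used by all the adversaries together. -/
def size (A : Adversary d m c n) : ℕ := A.anc + A.split.length + ∑ i, (A.pirate i).size

/-- The decryption key `ρ` together with the auxiliary qubits in state `|0⟩`. -/
def initState (A : Adversary d m c n) (ρ : Op (Fin d)) : Op (Fin d ⊕ Fin A.anc) := fun x y =>
  if ∀ j, x (Sum.inr j) = false ∧ y (Sum.inr j) = false then
    ρ (fun j => x (Sum.inl j)) (fun j => y (Sum.inl j))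
  else 0

/-- The state left by `A_0`, weighted with the probability of the event that `A_0` outputs the
plaintexts `(μ false, μ true)`. -/
def state (A : Adversary d m c n) (ρ : Op (Fin d)) (μ : Bool → Bits m) :
    Op (Fin d ⊕ Fin A.anc) :=
  let K := measProj (A.msg true) (μ true) * measProj (A.msg false) (μ false) *
    circuitMat (fun j => j.elim0) A.split
  K * A.initState ρ * Kᴴ

end Adversary

namespace Scheme

variable (S : Scheme)

/-- The tuples of adversaries against `S` with `n` second-stage adversaries. -/
abbrev Adv (k n : ℕ) : Type := Adversary (S.dkLen k) (S.msgLen k) (S.ctLen k) n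

/-- The probability that the challenger outputs `1` in the one-time strong anti-piracy game: the
projective implementations for the two programs are applied one after the other, and both outcomes
are larger than `1 / 2 + γ`. -/
def strongWin (k : ℕ) (A : S.Adv k 2) (γ : ℝ) : ℝ :=
  ∑ ek, ∑ μ : Bool → S.space k, ∑ u₁, ∑ u₂,
    let P₁ := (A.pirate 0).mixture u₁ (fun b => S.enc k ek (μ b))
    let P₂ := (A.pirate 1).mixture u₂ (fun b => S.enc k ek (μ b))
    ∑ p₁ ∈ (outcomes P₁).filter (fun p => 1 / 2 + γ < p),
      ∑ p₂ ∈ (outcomes P₂).filter (fun p => 1 / 2 + γ < p),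
        prob (projImp P₂ p₂ * projImp P₁ p₁ * (A.pirate 1).kraus u₂ * (A.pirate 0).kraus u₁)
          (A.state (S.kg k ek) (fun b => (μ b).val))

/-- The probability that the challenger outputs `1` in the one-out-of-many one-time anti-piracy
game: for uniform `α` and `coin` and `ct ← Enc(ek, m_coin)`, the program of `A_α` outputs `coin`
on input `ct`. -/
def oneOutOfManyWin (k n : ℕ) (A : S.Adv k n) : ℝ :=
  ∑ α, (1 / (n : ℝ)) * ∑ coin, (1 / 2 : ℝ) *
    ∑ ek, ∑ μ : Bool → S.space k, ∑ u, ∑ ct, (S.enc k ek (μ coin) ct).toReal *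
      prob (bitProj (A.pirate α).out coin * (A.pirate α).unitary u ct * (A.pirate α).kraus u)
        (A.state (S.kg k ek) (fun b => (μ b).val))

/-- Quantum polynomial time, in the usual (non-uniform) circuit model: an adversary is a family of
circuits, one for each value of the security parameter, and the total number of gates and auxiliary
qubits is polynomially bounded in the security parameter. -/
def QPT {n : ℕ → ℕ} (A : ∀ k, S.Adv k (n k)) : Prop := PolyBounded fun k => (A k).size

/-- One-time strong anti-piracy security. -/
def StrongAntiPiracy : Prop :=
  ∀ γ : ℕ → ℝ, InversePoly γ → ∀ A : ∀ k, S.Adv k 2, S.QPT A →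
    Negligible fun k => S.strongWin k (A k) (γ k)

/-- One-out-of-many one-time anti-piracy security. -/
def OneOutOfManyAntiPiracy : Prop :=
  ∀ n : ℕ → ℕ, (∀ k, 2 ≤ n k) → PolyBounded n → ∀ A : ∀ k, S.Adv k (n k), S.QPT A →
    ∃ ν : ℕ → ℝ, Negligible ν ∧
      ∀ k, S.oneOutOfManyWin k (n k) (A k) ≤ 1 / 2 + 1 / (2 * (n k : ℝ)) + ν k

end Scheme

end

end SDE

namespace SDE

open scoped MatrixOrder

/-! ### Positive operators -/

section Positive

variable {ι : Type*} [Fintype ι] [DecidableEq ι]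

/-! For fixed keys and plaintexts let `T_i` be the effect "the program of `A_i` passes the threshold
test at `1/2 + γ`" (`good`) and `G_i` the effect "that program guesses the coin" (`guess`). A
program that fails the test lies in eigenspaces of eigenvalue at most `1/2 + γ`, and one that passes
guesses with probability at most `1`, so `G_i ≤ (1/2 + γ) + T_i / 2` (`guess_le`).

The `T_i` live on disjoint registers, hence commute (`localAlg_commute`, `good_mem`). For commuting
effects a Bonferroni inequality gives `∑ T_i ≤ 1 + ∑_{i ≠ j} T_i T_j`: if no two programs pass
together, on average at most one passes. Averaging `G_i` over `i` therefore yields `1/2 + γ +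
1/(2n)` plus `1/(2n)` times the pair terms.

The expectation of `T_i T_j` is exactly the strong anti-piracy winning probability of `(A_0, A_i,
A_j)` (`sum_prob_eq`, `strongWin_restrict`). Picking the best pair for each security parameter,
which non-uniformity allows, bounds the excess by `γ + n s` with `s` negligible (`exists_restrict`).
Since `γ` can be any inverse polynomial, the excess is negligible. -/

theorem trace_mul_re_nonneg {X ρ : Matrix ι ι ℂ} (hX : 0 ≤ X) (hρ : 0 ≤ ρ) :
    0 ≤ (X * ρ).trace.re := by
  obtain ⟨B, rfl⟩ := CStarAlgebra.nonneg_iff_eq_star_mul_self.1 hX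
  have h := ((Matrix.nonneg_iff_posSemidef.1 hρ).mul_mul_conjTranspose_same B).trace_nonneg
  rw [Matrix.trace_mul_comm, ← mul_assoc] at h
  exact (Complex.nonneg_iff.1 h).1

theorem trace_mul_re_mono {X Y ρ : Matrix ι ι ℂ} (h : X ≤ Y) (hρ : 0 ≤ ρ) :
    (X * ρ).trace.re ≤ (Y * ρ).trace.re := by
  have := trace_mul_re_nonneg (sub_nonneg.2 h) hρ
  rw [sub_mul, Matrix.trace_sub, Complex.sub_re] at this
  linarith

omit [DecidableEq ι] in
theorem conj_mono {X Y : Matrix ι ι ℂ} (h : X ≤ Y) (K : Matrix ι ι ℂ) :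
    Kᴴ * X * K ≤ Kᴴ * Y * K :=
  star_left_conjugate_le_conjugate h K

/-- A Bonferroni inequality for commuting effects. -/
theorem bonferroni {κ : Type*} [DecidableEq κ] (T : κ → Matrix ι ι ℂ) (h0 : ∀ i, 0 ≤ T i)
    (h1 : ∀ i, T i ≤ 1) (hc : ∀ i j, Commute (T i) (T j)) (s : Finset κ) :
    ∑ i ∈ s, T i ≤ 1 + ∑ p ∈ s.offDiag, T p.1 * T p.2 := by
  induction s using Finset.induction_on with
  | empty => simp
  | insert a s ha ih =>
    have hE : 0 ≤ ∑ p ∈ s.offDiag, T p.1 * T p.2 :=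
      Finset.sum_nonneg fun p _ => Commute.mul_nonneg (h0 _) (h0 _) (hc _ _)
    have hS : 0 ≤ ∑ i ∈ s, T i := Finset.sum_nonneg fun i _ => h0 i
    have hcS : Commute (T a) (∑ i ∈ s, T i) := Commute.sum_right _ _ _ fun i _ => hc a i
    have hcE : Commute (T a) (∑ p ∈ s.offDiag, T p.1 * T p.2) :=
      Commute.sum_right _ _ _ fun p _ => (hc a _).mul_right (hc a _)
    have hsum : ∑ p ∈ (insert a s).offDiag, T p.1 * T p.2
        = ∑ p ∈ s.offDiag, T p.1 * T p.2 + T a * ∑ i ∈ s, T i + (∑ i ∈ s, T i) * T a := by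
      rw [Finset.offDiag_insert ha, Finset.sum_union, Finset.sum_union]
      · simp only [Finset.mul_sum, Finset.sum_mul, Finset.sum_product, Finset.sum_singleton]
      · rw [Finset.disjoint_left]; rintro ⟨x, y⟩; simp; grind
      · rw [Finset.disjoint_left]; rintro ⟨x, y⟩; simp; grind
    rw [Finset.sum_insert ha, hsum, ← hcS.eq, ← sub_nonneg]
    set S := ∑ i ∈ s, T i
    set E := ∑ p ∈ s.offDiag, T p.1 * T p.2
    -- With `T = T a`, the claim is `0 ≤ 1 + E - S - T + 2TS`. The right side equals `(1 - T)(1 + E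
    -- - S) + T(E + S)`, an interpolation between the cases `T = 0` (the induction hypothesis) and
    -- `T = 1`. The factor 2 arises because `offDiag` counts ordered pairs.
    have hF : 0 ≤ (1 - T a) * (1 + E - S) :=
      Commute.mul_nonneg (sub_nonneg.2 (h1 a)) (sub_nonneg.2 ih)
        ((Commute.one_left _).sub_left
          (((Commute.one_right _).add_right hcE).sub_right hcS))
    have hG : 0 ≤ T a * (E + S) :=
      Commute.mul_nonneg (h0 a) (add_nonneg hE hS) (hcE.add_right hcS)
    refine (add_nonneg hF hG).trans_eq ?_
    noncomm_ring

end Positive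

noncomputable section

/-! ### Operators local to a register, and their commutation. -/

section Local

variable {W : Type} [Fintype W] [DecidableEq W] {c : ℕ}

/-- The operator acts as the identity on all wires outside `R`. -/
def Loc (R : Set W) (M : Op W) : Prop :=
  (∀ x y, M x y ≠ 0 → ∀ v ∉ R, x v = y v) ∧
  ∀ x y x' y', (∀ v ∉ R, x v = y v) → (∀ v ∉ R, x' v = y' v) →
    (∀ v ∈ R, x v = x' v) → (∀ v ∈ R, y v = y' v) → M x y = M x' y'

omit [Fintype W] [DecidableEq W] in
theorem Loc.conjTranspose {R : Set W} {M : Op W} (h : Loc R M) : Loc R Mᴴ := by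
  refine ⟨fun x y hxy v hv => ?_, fun x y x' y' h1 h2 h3 h4 => ?_⟩
  · refine (h.1 y x ?_ v hv).symm
    intro h0; simp [Matrix.conjTranspose_apply, h0] at hxy
  · simp only [Matrix.conjTranspose_apply]
    rw [h.2 y x y' x' (fun v hv => (h1 v hv).symm) (fun v hv => (h2 v hv).symm) h4 h3]

-- Only one intermediate basis state survives: `M` preserves the wires off `R`, and `N` preserves
-- those off `R'`, in particular those in `R`. So it agrees with `x` off `R` and with `z` on `R`.
open scoped Classical in
theorem Loc.mul_apply {R R' : Set W} (hR : Disjoint R R') {M N : Op W} (hM : Loc R M)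
    (hN : Loc R' N) (x z : W → Bool) :
    (M * N) x z = M x (R.piecewise z x) * N (R.piecewise z x) z := by
  rw [Matrix.mul_apply]
  refine Finset.sum_eq_single _ (fun y _ hy => ?_) (by simp)
  by_contra h
  rw [mul_eq_zero, not_or] at h
  apply hy
  ext v
  by_cases hv : v ∈ R
  · simpa [hv] using hN.1 _ _ h.2 v (Set.disjoint_left.1 hR hv)
  · simpa [hv] using (hM.1 _ _ h.1 v hv).symm

open scoped Classical in
theorem Loc.commute {R R' : Set W} (hR : Disjoint R R') {M N : Op W} (hM : Loc R M)
    (hN : Loc R' N) : Commute M N := by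
  ext x z
  rw [hM.mul_apply hR hN, hN.mul_apply hR.symm hM, mul_comm]
  by_cases hxz : ∀ v, v ∉ R → v ∉ R' → x v = z v
  · have hd : ∀ v, v ∈ R → v ∉ R' := fun v h => Set.disjoint_left.1 hR h
    congr 1
    · refine hN.2 _ _ _ _ ?_ ?_ ?_ ?_ <;> intro v hv <;> by_cases h : v ∈ R <;>
        by_cases h' : v ∈ R' <;> simp_all
    · refine hM.2 _ _ _ _ ?_ ?_ ?_ ?_ <;> intro v hv <;> by_cases h : v ∈ R <;>
        by_cases h' : v ∈ R' <;> simp_all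
  · push Not at hxz
    obtain ⟨v, h, h', hne⟩ := hxz
    have h1 : N (R.piecewise z x) z = 0 := by
      by_contra h0
      exact hne (by simpa [h] using hN.1 _ _ h0 v h')
    have h2 : N x (R'.piecewise z x) = 0 ∨ M (R'.piecewise z x) z = 0 := by
      right
      by_contra h0
      exact hne (by simpa [h'] using hM.1 _ _ h0 v h)
    rcases h2 with h2 | h2 <;> simp [h1, h2]

omit [DecidableEq W] in
theorem loc_diagonal {R : Set W} (f : (W → Bool) → ℂ)
    (hf : ∀ x x' : W → Bool, (∀ v ∈ R, x v = x' v) → f x = f x') : Loc R (Matrix.diagonal f) := by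
  refine ⟨fun x y hxy v _ => ?_, fun x y x' y' h1 h2 h3 h4 => ?_⟩
  · by_contra h
    exact hxy (Matrix.diagonal_apply_ne _ fun h' => h (by rw [h']))
  · have : x = y ↔ x' = y' := by
      constructor <;> rintro rfl <;> ext v <;> by_cases hv : v ∈ R
      · rw [← h3 v hv, h4 v hv]
      · exact h2 v hv
      · rw [h3 v hv, h4 v hv]
      · exact h1 v hv
    by_cases hxy : x = y
    · obtain rfl := this.1 hxy; subst hxy
      simp [hf x x' h3]
    · rw [Matrix.diagonal_apply_ne _ hxy, Matrix.diagonal_apply_ne _ (mt this.2 hxy)]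

/-- Bit flips of the wire `w`, controlled by wires in `R`, act on `R`. -/
theorem loc_update {R : Set W} {w : W} (hw : w ∈ R) (f : (W → Bool) → Bool)
    (hf : ∀ x x' : W → Bool, (∀ v ∈ R, x v = x' v) → f x = f x') :
    Loc R (fun x y => if x = Function.update y w (f y) then 1 else 0) := by
  refine ⟨fun x y hxy v hv => ?_, fun x y x' y' h1 h2 h3 h4 => ?_⟩
  · have hx : x = Function.update y w (f y) := by by_contra h; simp [h] at hxy
    rw [hx, Function.update_of_ne (fun h : v = w => hv (h ▸ hw))]
  · have key : (x = Function.update y w (f y)) ↔ (x' = Function.update y' w (f y')) := by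
      simp only [funext_iff]
      refine forall_congr' fun v => ?_
      by_cases hvw : v = w
      · subst hvw; simp [h3 v hw, hf y y' h4]
      · rw [Function.update_of_ne hvw, Function.update_of_ne hvw]
        by_cases hv : v ∈ R
        · rw [h3 v hv, h4 v hv]
        · simp [h1 v hv, h2 v hv]
    simp only [key]

theorem Gate.ActsOn.loc {R : Set W} {g : Gate W c} (h : g.ActsOn R) (z : Bits c) :
    Loc R (g.mat z) := by
  cases g with
  | had w =>
    have hw : w ∈ R := h
    refine ⟨fun x y hxy v hv => ?_, fun x y x' y' h1 h2 h3 h4 => ?_⟩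
    · by_contra hne
      refine hxy (if_neg fun hall => hne (hall v fun hv' => hv (hv' ▸ hw)))
    · have key : (∀ v, v ≠ w → x v = y v) ↔ (∀ v, v ≠ w → x' v = y' v) := by
        refine forall_congr' fun v => ?_
        by_cases hv : v ∈ R
        · rw [h3 v hv, h4 v hv]
        · simp [h1 v hv, h2 v hv]
      simp only [Gate.mat, key, h3 w hw, h4 w hw]
  | tee w =>
    refine loc_diagonal _ fun x x' hx => ?_
    rw [hx w h]
  | cnot v w ne =>
    exact loc_update h.2 (fun y => xor (y w) (y v)) fun x x' hx => by simp [hx _ h.1, hx _ h.2]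
  | flip j w =>
    exact loc_update (show w ∈ R from h) (fun y => xor (y w) (z j)) fun x x' hx => by
      simp [hx w h]

omit [DecidableEq W] in
theorem loc_measProj {R : Set W} {k : ℕ} {v : Fin k → W} (hv : ∀ j, v j ∈ R) (b : Bits k) :
    Loc R (measProj v b) :=
  loc_diagonal _ fun x x' hx => by simp only [hx _ (hv _)]

omit [DecidableEq W] in
theorem loc_bitProj {R : Set W} {w : W} (hw : w ∈ R) (b : Bool) : Loc R (bitProj w b) :=
  loc_diagonal _ fun x x' hx => by simp only [hx _ hw]

/-- The operators on the register `R`, as the bicommutant of the matrices which are the identity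
on the other wires. -/
def localAlg (R : Set W) : StarSubalgebra ℂ (Op W) :=
  StarSubalgebra.centralizer ℂ
    (StarSubalgebra.centralizer ℂ {N : Op W | Loc R N} : Set (Op W))

theorem Loc.mem_localAlg {R : Set W} {M : Op W} (h : Loc R M) : M ∈ localAlg R := by
  rw [localAlg, StarSubalgebra.mem_centralizer_iff]
  intro g hg
  have hg' := hg
  have hs := star_mem hg
  rw [SetLike.mem_coe, StarSubalgebra.mem_centralizer_iff] at hg'
  rw [StarSubalgebra.mem_centralizer_iff] at hs
  exact ⟨((hg' M h).1).symm, ((hs M h).1).symm⟩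

/-- Operators local to `R'` commute with those local to `R`, so they lie in the commutant that
defines `localAlg R` and commute with `M`. Hence `M` lies in the commutant that defines `localAlg
R'`. -/
theorem localAlg_commute {R R' : Set W} (hR : Disjoint R R') {M N : Op W} (hM : M ∈ localAlg R)
    (hN : N ∈ localAlg R') : Commute M N := by
  have h1 : M ∈ StarSubalgebra.centralizer ℂ {N : Op W | Loc R' N} := by
    rw [StarSubalgebra.mem_centralizer_iff]
    intro g hg
    have hg' : g ∈ StarSubalgebra.centralizer ℂ {N : Op W | Loc R N} := by
      rw [StarSubalgebra.mem_centralizer_iff]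
      intro f hf
      exact ⟨Loc.commute hR hf hg, Loc.commute hR (Loc.conjTranspose hf) hg⟩
    rw [localAlg, StarSubalgebra.mem_centralizer_iff] at hM
    exact hM g hg'
  rw [localAlg, StarSubalgebra.mem_centralizer_iff] at hN
  exact (hN M h1).1

/-- Whatever commutes with an operator commutes with its functional calculus. This is what the
bicommutant form of `localAlg` buys: spectral projectors of local operators are local at no further
cost. -/
theorem cfc_mem_localAlg {R : Set W} {M : Op W} (hM : M ∈ localAlg R) (f : ℝ → ℝ) :
    cfc f M ∈ localAlg R := by
  rw [localAlg, StarSubalgebra.mem_centralizer_iff] at *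
  intro g hg
  exact ⟨(Commute.cfc_real (Commute.symm (hM g hg).1) f).symm,
    (Commute.cfc_real (Commute.symm (hM g hg).2) f).symm⟩

theorem circuitMat_mem_localAlg {R : Set W} (z : Bits c) (l : List (Gate W c))
    (h : ∀ g ∈ l, g.ActsOn R) : circuitMat z l ∈ localAlg R := by
  induction l with
  | nil => exact one_mem _
  | cons g l ih =>
    exact mul_mem (ih fun g' hg' => h g' (List.mem_cons_of_mem _ hg'))
      ((h g List.mem_cons_self).loc z).mem_localAlg

end Local

/-! ### Gates are unitary, and basis measurements are complete. -/

section Unitary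

variable {W : Type} [Fintype W] [DecidableEq W] {c : ℕ}

theorem involution_conj_mul_self {M : Op W} (σ : (W → Bool) → (W → Bool))
    (hσ : ∀ y, σ (σ y) = y) (hM : ∀ x y, M x y = if x = σ y then 1 else 0) : Mᴴ * M = 1 := by
  ext x z
  rw [Matrix.mul_apply, Finset.sum_eq_single (σ x)]
  · have : σ x = σ z ↔ x = z := (Function.LeftInverse.injective hσ).eq_iff
    simp [Matrix.one_apply, this, hM]
  · intro y _ hy
    simp [hy, hM]
  · simp

/-- Reduces the matrix product of two Hadamard gates on `w` to a sum of two terms. -/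
theorem sum_agree_off (w : W) (x : W → Bool) (f : (W → Bool) → ℂ)
    (hf : ∀ y, (¬ ∀ v, v ≠ w → y v = x v) → f y = 0) :
    ∑ y, f y = f (Function.update x w true) + f (Function.update x w false) := by
  have hne : Function.update x w true ≠ Function.update x w false := fun h => by
    simpa using congrFun h w
  rw [← Finset.sum_pair hne]
  refine (Finset.sum_subset (Finset.subset_univ _) fun y _ hy => hf y fun h => hy ?_).symm
  have : y = Function.update x w (y w) := by
    ext v
    by_cases hv : v = w
    · subst hv; simp
    · simp [hv, h v hv]
  rw [this]
  cases y w <;> simp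

theorem had_conj_mul_self (w : W) (z : Bits c) :
    ((Gate.had w : Gate W c).mat z)ᴴ * (Gate.had w : Gate W c).mat z = 1 := by
  have hs : ((Real.sqrt 2 : ℝ) : ℂ) * ((Real.sqrt 2 : ℝ) : ℂ) = 2 := by
    rw [← Complex.ofReal_mul, Real.mul_self_sqrt (by norm_num)]; norm_num
  have hs0 : ((Real.sqrt 2 : ℝ) : ℂ) ≠ 0 := fun h => by simp [h] at hs
  have hm : ∀ x y, (Gate.had w : Gate W c).mat z x y = if ∀ v, v ≠ w → x v = y v then
      (if x w = true ∧ y w = true then -1 else 1) / ((Real.sqrt 2 : ℝ) : ℂ) else 0 :=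
    fun _ _ => rfl
  ext x y
  rw [Matrix.mul_apply, sum_agree_off w x]
  · by_cases hxy : ∀ v, v ≠ w → x v = y v
    · have h1 : ∀ b, ∀ v, v ≠ w → Function.update x w b v = y v := fun b v hv => by
        simp [hv, hxy v hv]
      have h2 : ∀ b, ∀ v, v ≠ w → Function.update x w b v = x v := fun b v hv => by simp [hv]
      have h3 : x = y ↔ x w = y w := by
        refine ⟨fun h => by rw [h], fun h => ?_⟩
        ext v
        by_cases hv : v = w
        · rw [hv, h]
        · exact hxy v hv
      simp only [hm, Matrix.conjTranspose_apply, if_pos (h1 _), if_pos (h2 _),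
        Function.update_self, Matrix.one_apply, h3]
      cases x w <;> cases y w <;> simp <;> field_simp <;> rw [sq, hs] <;> norm_num
    · have h1 : ∀ b, ¬ ∀ v, v ≠ w → Function.update x w b v = y v := fun b h => hxy fun v hv => by
        simpa [hv] using h v hv
      have h3 : x ≠ y := fun h => hxy fun v _ => by rw [h]
      simp only [hm, if_neg (h1 _), Matrix.one_apply, if_neg h3, mul_zero, add_zero]
  · intro u hu
    simp only [hm, Matrix.conjTranspose_apply, if_neg hu, star_zero, zero_mul]

theorem Gate.conj_mul_self (g : Gate W c) (z : Bits c) : (g.mat z)ᴴ * g.mat z = 1 := by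
  cases g with
  | had w => exact had_conj_mul_self w z
  | tee w =>
    simp only [Gate.mat, Matrix.diagonal_conjTranspose, Matrix.diagonal_mul_diagonal]
    rw [← Matrix.diagonal_one]
    congr 1
    ext x
    by_cases h : x w = true
    · simp only [Pi.star_apply, h, if_true, RCLike.star_def, ← Complex.exp_conj,
        ← Complex.exp_add]
      simp [map_ofNat]
    · simp [h]
  | cnot v w ne =>
    refine involution_conj_mul_self (fun y => Function.update y w (xor (y w) (y v)))
      (fun y => ?_) fun _ _ => rfl
    simp [Function.update_of_ne ne]
  | flip j w =>
    refine involution_conj_mul_self (fun y => Function.update y w (xor (y w) (z j)))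
      (fun y => ?_) fun _ _ => rfl
    simp

theorem circuitMat_conj_mul_self (z : Bits c) (l : List (Gate W c)) :
    (circuitMat z l)ᴴ * circuitMat z l = 1 := by
  induction l with
  | nil => simp [circuitMat]
  | cons g l ih =>
    rw [circuitMat, Matrix.conjTranspose_mul, mul_assoc, ← mul_assoc (circuitMat z l)ᴴ, ih,
      one_mul, g.conj_mul_self]

omit [DecidableEq W] in
theorem bitProj_isHermitian (w : W) (b : Bool) : (bitProj w b)ᴴ = bitProj w b := by
  rw [bitProj, Matrix.diagonal_conjTranspose]
  congr 1; ext x; simp [apply_ite]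

theorem bitProj_mul_self (w : W) (b : Bool) : bitProj w b * bitProj w b = bitProj w b := by
  simp [bitProj]

omit [DecidableEq W] in
theorem bitProj_nonneg (w : W) (b : Bool) : 0 ≤ bitProj w b := by
  rw [Matrix.nonneg_iff_posSemidef, bitProj, Matrix.posSemidef_diagonal_iff]
  intro x; split_ifs <;> simp

omit [DecidableEq W] in
theorem bitProj_le_one (w : W) (b : Bool) : bitProj w b ≤ 1 := by
  rw [Matrix.le_iff, bitProj, ← Matrix.diagonal_one, Matrix.diagonal_sub,
    Matrix.posSemidef_diagonal_iff]
  intro x; split_ifs <;> simp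

omit [DecidableEq W] in
theorem measProj_isHermitian {k : ℕ} (v : Fin k → W) (b : Bits k) :
    (measProj v b)ᴴ = measProj v b := by
  rw [measProj, Matrix.diagonal_conjTranspose]
  congr 1; ext x; simp [apply_ite]

theorem measProj_mul_self {k : ℕ} (v : Fin k → W) (b : Bits k) :
    measProj v b * measProj v b = measProj v b := by
  simp [measProj]

omit [DecidableEq W] in
theorem sum_measProj {k : ℕ} (v : Fin k → W) : ∑ b, measProj v b = 1 := by
  ext x y
  rw [Matrix.sum_apply]
  by_cases hxy : x = y
  · subst hxy
    rw [Finset.sum_eq_single (fun j => x (v j))]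
    · simp [measProj]
    · intro b _ hb
      rw [measProj, Matrix.diagonal_apply_eq, if_neg fun h => hb (funext fun j => (h j).symm)]
    · simp
  · simp [measProj, hxy]

theorem prob_eq (K ρ : Op W) : prob K ρ = (Kᴴ * K * ρ).trace.re := by
  rw [prob, Matrix.trace_mul_comm, ← mul_assoc]

end Unitary

/-! ### Effects of a single second-stage adversary: guessing and the threshold test. -/

namespace Pirate

variable {W : Type} [Fintype W] [DecidableEq W] {c : ℕ} (B : Pirate W c)

theorem sum_kraus : ∑ u, (B.kraus u)ᴴ * B.kraus u = 1 := by
  have h : ∀ u, (B.kraus u)ᴴ * B.kraus u = (circuitMat (fun j => j.elim0) B.circ)ᴴ *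
      measProj B.sel u * circuitMat (fun j => j.elim0) B.circ := fun u => by
    rw [kraus, Matrix.conjTranspose_mul, measProj_isHermitian, mul_assoc, ← mul_assoc (measProj _ _),
      measProj_mul_self, mul_assoc]
  simp only [h]
  rw [← Finset.sum_mul, ← Finset.mul_sum, sum_measProj, mul_one, circuitMat_conj_mul_self]

theorem unitary_conj_mul_self (u : Bits B.slots) (ct : Bits c) :
    (B.unitary u ct)ᴴ * B.unitary u ct = 1 :=
  circuitMat_conj_mul_self _ _

theorem proj_nonneg (u : Bits B.slots) (b : Bool) (ct : Bits c) : 0 ≤ B.proj u b ct := by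
  simpa [proj] using conj_mono (bitProj_nonneg B.out b) (B.unitary u ct)

theorem proj_le_one (u : Bits B.slots) (b : Bool) (ct : Bits c) : B.proj u b ct ≤ 1 := by
  simpa [proj, unitary_conj_mul_self] using conj_mono (bitProj_le_one B.out b) (B.unitary u ct)

theorem sum_weights (enc : Bool → PMF (Bits c)) :
    ∑ b, ∑ ct, (1 / 2 * (enc b ct).toReal : ℝ) = 1 := by
  have h : ∀ b, ∑ ct, (enc b ct).toReal = 1 := fun b => by
    rw [← ENNReal.toReal_sum fun ct _ => (enc b).apply_ne_top ct,
      ← tsum_fintype (L := .unconditional _), (enc b).tsum_coe, ENNReal.toReal_one]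
  simp only [← Finset.mul_sum, h]
  norm_num

theorem mixture_nonneg (u : Bits B.slots) (enc : Bool → PMF (Bits c)) : 0 ≤ B.mixture u enc :=
  Finset.sum_nonneg fun b _ => Finset.sum_nonneg fun ct _ => Matrix.nonneg_iff_posSemidef.2 <|
    (Matrix.nonneg_iff_posSemidef.1 (B.proj_nonneg u b ct)).smul
      (Complex.zero_le_real.2 (by positivity))

theorem mixture_le_one (u : Bits B.slots) (enc : Bool → PMF (Bits c)) : B.mixture u enc ≤ 1 := by
  have h : (1 : Op W) = ∑ b, ∑ ct, ((1 / 2 * (enc b ct).toReal : ℝ) : ℂ) • 1 := by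
    simp only [← Finset.sum_smul, ← Complex.ofReal_sum, sum_weights, Complex.ofReal_one, one_smul]
  rw [h, mixture]
  refine Finset.sum_le_sum fun b _ => Finset.sum_le_sum fun ct _ => ?_
  rw [← sub_nonneg, ← smul_sub, Matrix.nonneg_iff_posSemidef]
  exact (Matrix.le_iff.1 (B.proj_le_one u b ct)).smul (Complex.zero_le_real.2 (by positivity))

theorem isProjImp (u : Bits B.slots) (enc : Bool → PMF (Bits c)) :
    IsProjImp (B.mixture u enc) (outcomes (B.mixture u enc)) (projImp (B.mixture u enc)) :=
  isProjImp_projImp _ (Matrix.nonneg_iff_posSemidef.1 (B.mixture_nonneg u enc))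
    (Matrix.le_iff.1 (B.mixture_le_one u enc))

/-- The effect of "the program of `B` guesses the bit". -/
def guess (enc : Bool → PMF (Bits c)) : Op W :=
  ∑ u, (B.kraus u)ᴴ * B.mixture u enc * B.kraus u

/-- The projector onto the eigenspaces of eigenvalues larger than `1 / 2 + γ`. -/
def highProj (u : Bits B.slots) (enc : Bool → PMF (Bits c)) (γ : ℝ) : Op W :=
  ∑ p ∈ (outcomes (B.mixture u enc)).filter (fun p => 1 / 2 + γ < p),
    projImp (B.mixture u enc) p

/-- The effect of "the program of `B` is tested to guess with probability above `1 / 2 + γ`". -/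
def good (enc : Bool → PMF (Bits c)) (γ : ℝ) : Op W :=
  ∑ u, (B.kraus u)ᴴ * B.highProj u enc γ * B.kraus u

theorem projImp_nonneg {u : Bits B.slots} {enc : Bool → PMF (Bits c)} {p : ℝ}
    (hp : p ∈ outcomes (B.mixture u enc)) : 0 ≤ projImp (B.mixture u enc) p := by
  have h := B.isProjImp u enc
  have h2 := star_mul_self_nonneg (projImp (B.mixture u enc) p)
  rwa [Matrix.star_eq_conjTranspose, (h.hermitian p hp).eq, h.idem p hp] at h2

variable (enc : Bool → PMF (Bits c)) {γ : ℝ}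

theorem highProj_nonneg (u : Bits B.slots) : 0 ≤ B.highProj u enc γ :=
  Finset.sum_nonneg fun _ hp => B.projImp_nonneg (Finset.mem_filter.1 hp).1

theorem highProj_le_one (u : Bits B.slots) : B.highProj u enc γ ≤ 1 := by
  rw [← (B.isProjImp u enc).sum_eq_one]
  exact Finset.sum_le_sum_of_subset_of_nonneg (Finset.filter_subset _ _)
    fun p hp _ => B.projImp_nonneg hp

/-- Compared on each eigenspace: an eigenvalue that is not high is at most `1 / 2 + γ`, and a high
one is at most `1 ≤ (1 / 2 + γ) + 1 / 2`. The weight `1 / 2` of `highProj` is the source of the term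
`1 / (2n)` in the final bound. -/
theorem mixture_le (hγ : 0 ≤ γ) (u : Bits B.slots) :
    B.mixture u enc ≤
      ((1 / 2 + γ : ℝ) : ℂ) • 1 + ((1 / 2 : ℝ) : ℂ) • B.highProj u enc γ := by
  have h := B.isProjImp u enc
  conv_lhs => rw [← h.implements]
  rw [← h.sum_eq_one, highProj, Finset.sum_filter, Finset.smul_sum, Finset.smul_sum,
    ← Finset.sum_add_distrib]
  refine Finset.sum_le_sum fun p hp => ?_
  have hpos := Matrix.nonneg_iff_posSemidef.1 (B.projImp_nonneg hp)
  have h1 := (h.mem_unit p hp).2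
  split_ifs with hlt
  · rw [← add_smul, ← sub_nonneg, ← sub_smul, Matrix.nonneg_iff_posSemidef, ← Complex.ofReal_add,
      ← Complex.ofReal_sub]
    exact hpos.smul (Complex.zero_le_real.2 (by linarith))
  · rw [smul_zero, add_zero, ← sub_nonneg, ← sub_smul, Matrix.nonneg_iff_posSemidef,
      ← Complex.ofReal_sub]
    exact hpos.smul (Complex.zero_le_real.2 (by linarith))

/-- `mixture_le` conjugated by the Kraus operators and summed over the measured description `u`;
completeness of the Kraus operators preserves the scalar term. -/
theorem guess_le (hγ : 0 ≤ γ) :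
    B.guess enc ≤ ((1 / 2 + γ : ℝ) : ℂ) • 1 + ((1 / 2 : ℝ) : ℂ) • B.good enc γ := by
  have h := Finset.sum_le_sum fun (u : Bits B.slots) (_ : u ∈ Finset.univ) =>
    conj_mono (B.mixture_le enc hγ u) (B.kraus u)
  refine h.trans_eq ?_
  simp only [mul_add, add_mul, Matrix.mul_smul, Matrix.smul_mul, mul_one, Finset.sum_add_distrib,
    ← Finset.smul_sum, sum_kraus, good]

theorem good_nonneg : 0 ≤ B.good enc γ :=
  Finset.sum_nonneg fun u _ => by
    simpa using conj_mono (B.highProj_nonneg enc (γ := γ) u) (B.kraus u)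

theorem good_le_one : B.good enc γ ≤ 1 := by
  rw [← B.sum_kraus]
  exact Finset.sum_le_sum fun u _ => by
    simpa using conj_mono (B.highProj_le_one enc (γ := γ) u) (B.kraus u)

section Local

variable {B} {R : Set W} (hB : B.ActsOn R)
include hB

theorem kraus_mem (u : Bits B.slots) : B.kraus u ∈ localAlg R :=
  mul_mem (loc_measProj hB.2.1 u).mem_localAlg (circuitMat_mem_localAlg _ _ hB.1)

theorem unitary_mem (u : Bits B.slots) (ct : Bits c) : B.unitary u ct ∈ localAlg R := by
  refine circuitMat_mem_localAlg _ _ fun g hg => ?_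
  obtain ⟨j, -, rfl⟩ := List.mem_map.1 hg
  exact hB.2.2.1 j

theorem mixture_mem (u : Bits B.slots) : B.mixture u enc ∈ localAlg R :=
  sum_mem fun b _ => sum_mem fun ct _ => SMulMemClass.smul_mem _ <|
    mul_mem (mul_mem (star_mem (unitary_mem hB u ct)) (loc_bitProj hB.2.2.2 b).mem_localAlg)
      (unitary_mem hB u ct)

theorem projImp_mem (u : Bits B.slots) (p : ℝ) : projImp (B.mixture u enc) p ∈ localAlg R :=
  cfc_mem_localAlg (mixture_mem enc hB u) _

theorem good_mem : B.good enc γ ∈ localAlg R :=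
  sum_mem fun u _ => mul_mem (mul_mem (star_mem (kraus_mem hB u))
    (sum_mem fun p _ => projImp_mem enc hB u p)) (kraus_mem hB u)

end Local

/-- Testing two programs on disjoint registers one after the other. -/
theorem sum_prob_eq {B₁ B₂ : Pirate W c} {R₁ R₂ : Set W} (h₁ : B₁.ActsOn R₁) (h₂ : B₂.ActsOn R₂)
    (hR : Disjoint R₁ R₂) (ρ : Op W) :
    ∑ u₁, ∑ u₂, ∑ p₁ ∈ (outcomes (B₁.mixture u₁ enc)).filter (fun p => 1 / 2 + γ < p),
      ∑ p₂ ∈ (outcomes (B₂.mixture u₂ enc)).filter (fun p => 1 / 2 + γ < p),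
        prob (projImp (B₂.mixture u₂ enc) p₂ * projImp (B₁.mixture u₁ enc) p₁ *
          B₂.kraus u₂ * B₁.kraus u₁) ρ
      = (B₁.good enc γ * B₂.good enc γ * ρ).trace.re := by
  have key : ∀ u₁ u₂, ∀ p₁ ∈ outcomes (B₁.mixture u₁ enc), ∀ p₂ ∈ outcomes (B₂.mixture u₂ enc),
      prob (projImp (B₂.mixture u₂ enc) p₂ * projImp (B₁.mixture u₁ enc) p₁ *
          B₂.kraus u₂ * B₁.kraus u₁) ρ =
      (((B₁.kraus u₁)ᴴ * projImp (B₁.mixture u₁ enc) p₁ * B₁.kraus u₁) *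
        ((B₂.kraus u₂)ᴴ * projImp (B₂.mixture u₂ enc) p₂ * B₂.kraus u₂) * ρ).trace.re := by
    intro u₁ u₂ p₁ hp₁ p₂ hp₂
    have hE₁ := projImp_mem enc h₁ u₁ p₁
    have hE₂ := projImp_mem enc h₂ u₂ p₂
    have hK₁ := kraus_mem h₁ u₁
    have hK₂ := kraus_mem h₂ u₂
    have hK₂' : (B₂.kraus u₂)ᴴ ∈ localAlg R₂ := star_mem hK₂
    have i₁ := (B₁.isProjImp u₁ enc).idem p₁ hp₁
    have i₂ := (B₂.isProjImp u₂ enc).idem p₂ hp₂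
    have s₁ := ((B₁.isProjImp u₁ enc).hermitian p₁ hp₁).eq
    have s₂ := ((B₂.isProjImp u₂ enc).hermitian p₂ hp₂).eq
    rw [prob_eq]
    generalize projImp (B₁.mixture u₁ enc) p₁ = E₁ at *
    generalize projImp (B₂.mixture u₂ enc) p₂ = E₂ at *
    generalize B₁.kraus u₁ = K₁ at *
    generalize B₂.kraus u₂ = K₂ at *
    have c₁ := (localAlg_commute hR hE₁ hE₂).eq
    have c₂ := (localAlg_commute hR hE₁ hK₂').eq
    have c₃ := (localAlg_commute hR hK₁ (mul_mem (mul_mem hK₂' hE₂) hK₂)).eq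
    -- Each test projector is idempotent, and operators of one adversary commute with those of the
    -- other. The joint effect thus factors into the effects of the two separate tests.
    refine congrArg (fun X : Op W => (X * ρ).trace.re) ?_
    calc (E₂ * E₁ * K₂ * K₁)ᴴ * (E₂ * E₁ * K₂ * K₁)
        = K₁ᴴ * K₂ᴴ * (E₁ * (E₂ * E₂) * E₁) * K₂ * K₁ := by
          simp only [Matrix.conjTranspose_mul, s₁, s₂, mul_assoc]
      _ = K₁ᴴ * K₂ᴴ * (E₁ * E₁ * E₂) * K₂ * K₁ := by rw [i₂, mul_assoc E₁ E₂, mul_assoc E₁ E₁, ← c₁]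
      _ = K₁ᴴ * (K₂ᴴ * E₁) * E₂ * K₂ * K₁ := by rw [i₁]; simp only [mul_assoc]
      _ = K₁ᴴ * E₁ * (K₂ᴴ * E₂ * K₂ * K₁) := by rw [← c₂]; simp only [mul_assoc]
      _ = _ := by rw [← c₃]; simp only [mul_assoc]
  have h : B₁.good enc γ * B₂.good enc γ * ρ = ∑ u₁, ∑ u₂,
      ∑ p₁ ∈ (outcomes (B₁.mixture u₁ enc)).filter (fun p => 1 / 2 + γ < p),
      ∑ p₂ ∈ (outcomes (B₂.mixture u₂ enc)).filter (fun p => 1 / 2 + γ < p),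
      ((B₁.kraus u₁)ᴴ * projImp (B₁.mixture u₁ enc) p₁ * B₁.kraus u₁) *
        ((B₂.kraus u₂)ᴴ * projImp (B₂.mixture u₂ enc) p₂ * B₂.kraus u₂) * ρ := by
    rw [good, good, Finset.sum_mul_sum, Finset.sum_mul]
    refine Finset.sum_congr rfl fun u₁ _ => ?_
    rw [Finset.sum_mul]
    refine Finset.sum_congr rfl fun u₂ _ => ?_
    simp only [highProj, Finset.mul_sum, Finset.sum_mul]
    rw [Finset.sum_comm]
  rw [h]
  simp only [Matrix.trace_sum, Complex.re_sum]
  exact Finset.sum_congr rfl fun u₁ _ => Finset.sum_congr rfl fun u₂ _ =>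
    Finset.sum_congr rfl fun p₁ hp₁ => Finset.sum_congr rfl fun p₂ hp₂ =>
      key u₁ u₂ p₁ (Finset.mem_filter.1 hp₁).1 p₂ (Finset.mem_filter.1 hp₂).1

/-- The probability that the program of `B` guesses a uniform bit. -/
theorem sum_prob_guess (ρ : Op W) :
    ∑ b, (1 / 2 : ℝ) * ∑ u, ∑ ct, (enc b ct).toReal *
      prob (bitProj B.out b * B.unitary u ct * B.kraus u) ρ = (B.guess enc * ρ).trace.re := by
  have h : ∀ u b ct, prob (bitProj B.out b * B.unitary u ct * B.kraus u) ρ =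
      ((B.kraus u)ᴴ * B.proj u b ct * B.kraus u * ρ).trace.re := fun u b ct => by
    rw [prob_eq]
    refine congrArg (fun X : Op W => (X * ρ).trace.re) ?_
    calc _ = (B.kraus u)ᴴ * (B.unitary u ct)ᴴ * (bitProj B.out b * bitProj B.out b) *
          B.unitary u ct * B.kraus u := by
          simp only [Matrix.conjTranspose_mul, bitProj_isHermitian, mul_assoc]
      _ = _ := by rw [bitProj_mul_self, proj]; simp only [mul_assoc]
  simp only [h, guess, mixture, Finset.mul_sum, Finset.sum_mul, Matrix.trace_sum, Complex.re_sum,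
    Matrix.mul_smul, Matrix.smul_mul, Matrix.trace_smul, smul_eq_mul, Complex.re_ofReal_mul]
  rw [Finset.sum_comm]
  simp only [mul_assoc]

end Pirate

/-! ### The state prepared by the first stage, and pairs of second-stage adversaries. -/

namespace Adversary

variable {d m c n : ℕ} (A : Adversary d m c n)

theorem initState_nonneg {ρ : Op (Fin d)} (hρ : ρ.PosSemidef) : 0 ≤ A.initState ρ := by
  have h : A.initState ρ =
      (Matrix.diagonal fun x : Fin d ⊕ Fin A.anc → Bool =>
        if ∀ j, x (Sum.inr j) = false then (1 : ℂ) else 0) *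
      ρ.submatrix (fun x j => x (Sum.inl j)) (fun x j => x (Sum.inl j)) *
      (Matrix.diagonal fun x : Fin d ⊕ Fin A.anc → Bool =>
        if ∀ j, x (Sum.inr j) = false then (1 : ℂ) else 0)ᴴ := by
    ext x y
    rw [Matrix.diagonal_conjTranspose, Matrix.mul_diagonal, Matrix.diagonal_mul]
    by_cases h1 : ∀ j, x (Sum.inr j) = false <;> by_cases h2 : ∀ j, y (Sum.inr j) = false <;>
      simp [initState, h1, h2, forall_and]
  rw [h, Matrix.nonneg_iff_posSemidef]
  exact (hρ.submatrix _).mul_mul_conjTranspose_same _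

theorem trace_initState (ρ : Op (Fin d)) : (A.initState ρ).trace = ρ.trace := by
  rw [Matrix.trace, ← (Equiv.sumArrowEquivProdArrow (Fin d) (Fin A.anc) Bool).symm.sum_comp,
    Fintype.sum_prod_type, Matrix.trace]
  refine Finset.sum_congr rfl fun a _ => ?_
  rw [Finset.sum_eq_single (fun _ => false)]
  · simp [initState, Equiv.sumArrowEquivProdArrow]
  · intro b _ hb
    have : ¬ ∀ j, b j = false := fun h => hb (funext h)
    simp [initState, Equiv.sumArrowEquivProdArrow, this]
  · simp

theorem state_nonneg {ρ : Op (Fin d)} (hρ : ρ.PosSemidef) (μ : Bool → Bits m) :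
    0 ≤ A.state ρ μ :=
  Matrix.nonneg_iff_posSemidef.2
    ((Matrix.nonneg_iff_posSemidef.1 (A.initState_nonneg hρ)).mul_mul_conjTranspose_same _)

theorem trace_state_re_nonneg {ρ : Op (Fin d)} (hρ : ρ.PosSemidef) (μ : Bool → Bits m) :
    0 ≤ (A.state ρ μ).trace.re :=
  (Complex.nonneg_iff.1
    (Matrix.nonneg_iff_posSemidef.1 (A.state_nonneg hρ μ)).trace_nonneg).1

/-- The two plaintext measurements are diagonal, so they commute even if their wires overlap, and
together they form one complete projective measurement. -/
theorem sum_trace_state (ρ : Op (Fin d)) : ∑ μ, (A.state ρ μ).trace = ρ.trace := by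
  set C : Op (Fin d ⊕ Fin A.anc) := circuitMat (fun j => j.elim0) A.split with hC
  have h : ∀ μ, (A.state ρ μ).trace = (Cᴴ * (measProj (A.msg false) (μ false) *
      measProj (A.msg true) (μ true)) * C * A.initState ρ).trace := by
    intro μ
    have hcomm : measProj (A.msg true) (μ true) * measProj (A.msg false) (μ false) =
        measProj (A.msg false) (μ false) * measProj (A.msg true) (μ true) := by
      simp only [measProj, Matrix.diagonal_mul_diagonal, mul_comm]
    rw [state, Matrix.trace_mul_comm, ← mul_assoc]
    refine congrArg (fun X => (X * A.initState ρ).trace) ?_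
    rw [← hC]
    calc _ = Cᴴ * (measProj (A.msg false) (μ false) * (measProj (A.msg true) (μ true) *
            measProj (A.msg true) (μ true)) * measProj (A.msg false) (μ false)) * C := by
          simp only [Matrix.conjTranspose_mul, measProj_isHermitian, mul_assoc]
      _ = _ := by
          rw [measProj_mul_self, mul_assoc (measProj _ _) (measProj _ _) (measProj _ _), hcomm,
            ← mul_assoc (measProj _ _) (measProj _ _) (measProj _ _), measProj_mul_self]
  simp only [h]
  rw [← Matrix.trace_sum, ← Finset.sum_mul, ← Finset.sum_mul, ← Finset.mul_sum,
    ← (Equiv.boolArrowEquivProd (Bits m)).symm.sum_comp, Fintype.sum_prod_type]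
  have hmeas : ∑ a, ∑ b, measProj (A.msg false) a * measProj (A.msg true) b = 1 := by
    simp only [← Finset.mul_sum, sum_measProj, mul_one]
  have hsum : ∑ a, ∑ b, measProj (A.msg false) ((Equiv.boolArrowEquivProd _).symm (a, b) false) *
      measProj (A.msg true) ((Equiv.boolArrowEquivProd _).symm (a, b) true) = 1 := hmeas
  rw [hsum, mul_one, hC, circuitMat_conj_mul_self, one_mul, trace_initState]

theorem disjoint_registers {i j : Fin n} (h : i ≠ j) :
    Disjoint {w | A.recipient w = some i} {w | A.recipient w = some j} :=
  Set.disjoint_left.2 fun _ hi hj => h (Option.some_injective _ (hi.symm.trans hj))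

/-- The adversaries `(A_0, A_i, A_j)`. -/
def restrict (i j : Fin n) (h : i ≠ j) : Adversary d m c 2 where
  anc := A.anc
  split := A.split
  msg := A.msg
  recipient w :=
    if A.recipient w = some i then some 0 else if A.recipient w = some j then some 1 else none
  pirate := ![A.pirate i, A.pirate j]
  isLocal := by
    have hji : ¬ j = i := fun h' => h h'.symm
    have h0 : {w | (if A.recipient w = some i then some (0 : Fin 2) else
        if A.recipient w = some j then some 1 else none) = some 0} =
        {w | A.recipient w = some i} := by
      ext w
      by_cases h1 : A.recipient w = some i <;> by_cases h2 : A.recipient w = some j <;>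
        simp [h1, h2, hji]
    have h1 : {w | (if A.recipient w = some i then some (0 : Fin 2) else
        if A.recipient w = some j then some 1 else none) = some 1} =
        {w | A.recipient w = some j} := by
      ext w
      by_cases h1 : A.recipient w = some i <;> by_cases h2 : A.recipient w = some j <;>
        simp_all
    rw [Fin.forall_fin_two, h0, h1]
    exact ⟨A.isLocal i, A.isLocal j⟩

theorem size_restrict_le (i j : Fin n) (h : i ≠ j) : (A.restrict i j h).size ≤ A.size := by
  have h1 : ∑ a, ((A.restrict i j h).pirate a).size = ∑ a ∈ {i, j}, (A.pirate a).size := by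
    rw [Fin.sum_univ_two, Finset.sum_pair h]
    rfl
  have h2 : ∑ a ∈ {i, j}, (A.pirate a).size ≤ ∑ a, (A.pirate a).size :=
    Finset.sum_le_sum_of_subset (Finset.subset_univ _)
  have h3 : (A.restrict i j h).anc + (A.restrict i j h).split.length =
      A.anc + A.split.length := rfl
  rw [size, size, h1, h3]
  lia

/-- `guess_le` summed over all adversaries, with `∑ good` bounded by `bonferroni`: the `1` there
contributes `1 / 2` once rather than `n` times. -/
theorem sum_guess_le (enc : Bool → PMF (Bits c)) {γ : ℝ} (hγ : 0 ≤ γ)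
    {ρ : Op (Fin d ⊕ Fin A.anc)} (hρ : 0 ≤ ρ) :
    ∑ α, ((A.pirate α).guess enc * ρ).trace.re ≤
      (n * (1 / 2 + γ) + 1 / 2) * ρ.trace.re + 1 / 2 * ∑ p ∈ Finset.univ.offDiag,
        ((A.pirate p.1).good enc γ * (A.pirate p.2).good enc γ * ρ).trace.re := by
  have hcomm : ∀ i j, Commute ((A.pirate i).good enc γ) ((A.pirate j).good enc γ) := by
    intro i j
    by_cases h : i = j
    · rw [h]
    · exact localAlg_commute (A.disjoint_registers h) (Pirate.good_mem enc (A.isLocal i))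
        (Pirate.good_mem enc (A.isLocal j))
  have hbon := trace_mul_re_mono (bonferroni (fun i => (A.pirate i).good enc γ)
    (fun i => (A.pirate i).good_nonneg enc) (fun i => (A.pirate i).good_le_one enc)
    hcomm Finset.univ) hρ
  rw [add_mul, one_mul, Finset.sum_mul, Finset.sum_mul, Matrix.trace_add, Complex.add_re,
    Matrix.trace_sum, Matrix.trace_sum, Complex.re_sum, Complex.re_sum] at hbon
  have hguess : ∀ α, ((A.pirate α).guess enc * ρ).trace.re ≤
      (1 / 2 + γ) * ρ.trace.re + 1 / 2 * ((A.pirate α).good enc γ * ρ).trace.re := by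
    intro α
    have h := trace_mul_re_mono ((A.pirate α).guess_le enc hγ) hρ
    rwa [add_mul, Matrix.smul_mul, Matrix.smul_mul, one_mul, Matrix.trace_add, Matrix.trace_smul,
      Matrix.trace_smul, smul_eq_mul, smul_eq_mul, Complex.add_re, Complex.re_ofReal_mul,
      Complex.re_ofReal_mul] at h
  have hsum := Finset.sum_le_sum fun α (_ : α ∈ Finset.univ) => hguess α
  rw [Finset.sum_add_distrib, Finset.sum_const, Finset.card_univ, Fintype.card_fin,
    nsmul_eq_mul, ← Finset.mul_sum] at hsum
  linarith

end Adversary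

/-! ### Comparing the two games. -/

namespace Scheme

variable (S : Scheme) {k n : ℕ}

/-- Restriction leaves the first-stage circuit, ancillas and plaintext wires alone, so the state is
definitionally the same, and `sum_prob_eq` evaluates the two tests. -/
theorem strongWin_restrict (A : S.Adv k n) (i j : Fin n) (h : i ≠ j) (γ : ℝ) :
    S.strongWin k (A.restrict i j h) γ = ∑ ek, ∑ μ : Bool → S.space k,
      ((A.pirate i).good (fun b => S.enc k ek (μ b)) γ *
        (A.pirate j).good (fun b => S.enc k ek (μ b)) γ *
        A.state (S.kg k ek) (fun b => (μ b).val)).trace.re :=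
  Finset.sum_congr rfl fun _ _ => Finset.sum_congr rfl fun _ _ =>
    Pirate.sum_prob_eq _ (A.isLocal i) (A.isLocal j) (A.disjoint_registers h) _

theorem strongWin_restrict_nonneg (A : S.Adv k n) (i j : Fin n) (h : i ≠ j) (γ : ℝ) :
    0 ≤ S.strongWin k (A.restrict i j h) γ := by
  rw [strongWin_restrict]
  exact Finset.sum_nonneg fun ek _ => Finset.sum_nonneg fun μ _ => trace_mul_re_nonneg
    (Commute.mul_nonneg ((A.pirate i).good_nonneg _) ((A.pirate j).good_nonneg _)
      (localAlg_commute (A.disjoint_registers h) (Pirate.good_mem _ (A.isLocal i))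
        (Pirate.good_mem _ (A.isLocal j)))) (A.state_nonneg (S.kg_pos k ek) _)

theorem oneOutOfManyWin_eq (A : S.Adv k n) :
    S.oneOutOfManyWin k n A = 1 / (n : ℝ) * ∑ ek, ∑ μ : Bool → S.space k, ∑ α,
      ((A.pirate α).guess (fun b => S.enc k ek (μ b)) *
        A.state (S.kg k ek) (fun b => (μ b).val)).trace.re := by
  have hswap : ∀ f : Fin n → Bool → Bits (S.ekLen k) → (Bool → S.space k) → ℝ,
      ∑ α, ∑ b, ∑ ek, ∑ μ, f α b ek μ = ∑ ek, ∑ μ, ∑ α, ∑ b, f α b ek μ := fun f =>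
    calc _ = ∑ α, ∑ ek, ∑ b, ∑ μ, f α b ek μ := Finset.sum_congr rfl fun _ _ => Finset.sum_comm
      _ = ∑ ek, ∑ α, ∑ b, ∑ μ, f α b ek μ := Finset.sum_comm
      _ = _ := Finset.sum_congr rfl fun _ _ =>
          (Finset.sum_congr rfl fun _ _ => Finset.sum_comm).trans Finset.sum_comm
  simp only [← Pirate.sum_prob_guess]
  rw [oneOutOfManyWin, ← Finset.mul_sum, ← hswap]
  simp only [← Finset.mul_sum]

/-- Only an inequality, because the first stage may measure strings outside the plaintext space;
such outcomes count as losses. -/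
theorem sum_trace_state_le (A : S.Adv k n) :
    ∑ ek, ∑ μ : Bool → S.space k, (A.state (S.kg k ek) (fun b => (μ b).val)).trace.re ≤ 1 := by
  have h : ∀ ek, ∑ μ : Bool → S.space k,
      (A.state (S.kg k ek) (fun b => (μ b).val)).trace.re ≤ (S.kg k ek).trace.re := by
    intro ek
    rw [← A.sum_trace_state, Complex.re_sum]
    have hinj : Function.Injective
        (fun (μ : Bool → S.space k) (b : Bool) => (μ b : Bits (S.msgLen k))) :=
      fun μ μ' hμ => funext fun b => Subtype.ext (congrFun hμ b)
    refine (Finset.sum_map Finset.univ ⟨_, hinj⟩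
      fun μ => (A.state (S.kg k ek) μ).trace.re).symm.trans_le ?_
    exact Finset.sum_le_sum_of_subset_of_nonneg (Finset.subset_univ _)
      fun μ _ _ => A.trace_state_re_nonneg (S.kg_pos k ek) μ
  refine (Finset.sum_le_sum fun ek _ => h ek).trans_eq ?_
  rw [← Complex.re_sum, S.kg_trace, Complex.one_re]

theorem oneOutOfManyWin_le (hn : 2 ≤ n) (A : S.Adv k n) {γ s : ℝ} (hγ : 0 ≤ γ)
    (hs0 : 0 ≤ s) (hs : ∀ i j h, S.strongWin k (A.restrict i j h) γ ≤ s) :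
    S.oneOutOfManyWin k n A ≤ 1 / 2 + 1 / (2 * (n : ℝ)) + (γ + n * s) := by
  have hn0 : (0 : ℝ) < n := by exact_mod_cast (by lia : 0 < n)
  have h1 := Finset.sum_le_sum fun ek (_ : ek ∈ Finset.univ) => Finset.sum_le_sum
    fun (μ : Bool → S.space k) (_ : μ ∈ Finset.univ) =>
      A.sum_guess_le (fun b => S.enc k ek (μ b)) hγ
        (A.state_nonneg (S.kg_pos k ek) (fun b => (μ b).val))
  simp only [Finset.sum_add_distrib, ← Finset.mul_sum] at h1
  have h2 : ∑ ek, ∑ μ : Bool → S.space k, ∑ p ∈ (Finset.univ : Finset (Fin n)).offDiag,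
      ((A.pirate p.1).good (fun b => S.enc k ek (μ b)) γ *
        (A.pirate p.2).good (fun b => S.enc k ek (μ b)) γ *
        A.state (S.kg k ek) (fun b => (μ b).val)).trace.re ≤ n * n * s := by
    simp only [Finset.sum_comm (t := (Finset.univ : Finset (Fin n)).offDiag)]
    have h3 : ∀ p ∈ (Finset.univ : Finset (Fin n)).offDiag, ∑ ek, ∑ μ : Bool → S.space k,
        ((A.pirate p.1).good (fun b => S.enc k ek (μ b)) γ *
        (A.pirate p.2).good (fun b => S.enc k ek (μ b)) γ *
        A.state (S.kg k ek) (fun b => (μ b).val)).trace.re ≤ s := by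
      intro p hp
      rw [← S.strongWin_restrict A p.1 p.2 (Finset.mem_offDiag.1 hp).2.2]
      exact hs _ _ _
    refine (Finset.sum_le_card_nsmul _ _ s h3).trans ?_
    rw [nsmul_eq_mul]
    refine mul_le_mul_of_nonneg_right ?_ hs0
    rw [Finset.offDiag_card, Finset.card_univ, Fintype.card_fin]
    exact_mod_cast Nat.sub_le _ _
  have h4 := mul_le_mul_of_nonneg_left (S.sum_trace_state_le A)
    (by positivity : 0 ≤ (n * (1 / 2 + γ) + 1 / 2 : ℝ))
  rw [oneOutOfManyWin_eq, div_mul_eq_mul_div, one_mul, div_le_iff₀ hn0]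
  have h5 : (1 / 2 + 1 / (2 * (n : ℝ)) + (γ + n * s)) * n =
      n * (1 / 2 + γ) + 1 / 2 + n * n * s := by
    field_simp
    ring
  -- The pair terms carry a factor `1 / 2`, which is given away here.
  have h6 : 0 ≤ n * n * s := by positivity
  rw [h5]
  linarith

/-- A choice of two second-stage adversaries which loses at most a factor `n` and `γ`. -/
theorem exists_restrict (hn : 2 ≤ n) (A : S.Adv k n) {γ : ℝ} (hγ : 0 ≤ γ) :
    ∃ B : S.Adv k 2, B.size ≤ A.size ∧ 0 ≤ S.strongWin k B γ ∧ S.oneOutOfManyWin k n A ≤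
      1 / 2 + 1 / (2 * (n : ℝ)) + (γ + n * S.strongWin k B γ) := by
  -- Two distinct indices exist because `2 ≤ n`; among the finitely many pairs the one that wins
  -- most often is taken.
  have : Nonempty {p : Fin n × Fin n // p.1 ≠ p.2} :=
    ⟨⟨(⟨0, by lia⟩, ⟨1, by lia⟩), by simp⟩⟩
  obtain ⟨p, hp⟩ := Finite.exists_max fun p : {p : Fin n × Fin n // p.1 ≠ p.2} =>
    S.strongWin k (A.restrict p.1.1 p.1.2 p.2) γ
  exact ⟨_, A.size_restrict_le _ _ p.2, S.strongWin_restrict_nonneg A _ _ _ _,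
    S.oneOutOfManyWin_le hn A hγ
    (S.strongWin_restrict_nonneg A _ _ _ _) fun i j h => hp ⟨(i, j), h⟩⟩

end Scheme

/-! ### Asymptotics. -/

theorem PolyBounded.negligible_mul {n : ℕ → ℕ} (hn : PolyBounded n) {ν : ℕ → ℝ}
    (hν : Negligible ν) : Negligible fun k => n k * ν k := by
  obtain ⟨p, hp⟩ := hn
  refine (hν.polynomial_mul (p.map (Nat.castRingHom ℝ))).trans_abs_le fun k => ?_
  have h : (p.map (Nat.castRingHom ℝ)).eval (k : ℝ) = (p.eval k : ℕ) := by
    rw [Polynomial.eval_natCast_map]; rfl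
  simp only [h, abs_mul, Nat.abs_cast]
  gcongr
  exact hp k

theorem inversePoly_inv_pow (e : ℕ) : InversePoly fun k => ((k : ℝ) ^ (e + 1))⁻¹ := by
  refine ⟨fun k => ⟨by positivity, ?_⟩, e + 1, Filter.Eventually.of_forall fun k => le_rfl⟩
  rcases Nat.eq_zero_or_pos k with rfl | hk
  · simp
  · exact inv_le_one_of_one_le₀ (one_le_pow₀ (by exact_mod_cast hk))

/-- A function is negligible if for every `e` it is at most `k ^ (-e)` up to a negligible term. -/
theorem negligible_of_forall_le {ν : ℕ → ℝ} (h0 : ∀ k, 0 ≤ ν k)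
    (h : ∀ e : ℕ, ∃ ε, Negligible ε ∧ ∀ k, ν k ≤ ((k : ℝ) ^ (e + 1))⁻¹ + ε k) : Negligible ν := by
  intro e
  obtain ⟨ε, hε, hle⟩ := h e
  -- The exponent `e + 1` leaves `k ^ e * (k ^ (e + 1))⁻¹ = k⁻¹`, which still tends to zero.
  have hlim := (tendsto_inv_atTop_nhds_zero_nat (𝕜 := ℝ)).add (hε e)
  rw [add_zero] at hlim
  refine squeeze_zero (fun k => mul_nonneg (by positivity) (h0 k)) (fun k => ?_) hlim
  refine (mul_le_mul_of_nonneg_left (hle k) (by positivity)).trans ?_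
  rw [mul_add]
  gcongr
  rcases Nat.eq_zero_or_pos k with rfl | hk
  · simp
  · have : (k : ℝ) ≠ 0 := by positivity
    rw [pow_succ, mul_inv, mul_inv_cancel_left₀ (pow_ne_zero _ this)]

end

end SDE

theorem mainTheorem3 (S : SDE.Scheme) (hS : S.StrongAntiPiracy) :
    S.OneOutOfManyAntiPiracy := by
  intro n hn hpoly A hA
  let excess : ℕ → ℝ := fun k =>
    S.oneOutOfManyWin k (n k) (A k) - (1 / 2 + 1 / (2 * (n k : ℝ)))
  -- The excess may be very negative, and negligibility is two-sided; hence the positive part.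
  refine ⟨fun k => max 0 (excess k), ?_, fun k => sub_le_iff_le_add'.1 (le_max_right 0 (excess k))⟩
  refine SDE.negligible_of_forall_le (fun k => le_max_left _ _) fun e => ?_
  have hγ := SDE.inversePoly_inv_pow e
  -- The pair is chosen separately for each `k` and for the `γ` of this `e`; the circuit family
  -- stays polynomially bounded because restriction does not increase the size.
  choose B hB hB0 hwin using fun k => S.exists_restrict (hn k) (A k) (hγ.1 k).1
  obtain ⟨p, hp⟩ := hA
  have hneg := hpoly.negligible_mul (hS _ hγ B ⟨p, fun k => (hB k).trans (hp k)⟩)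
  exact ⟨_, hneg, fun k => max_le
    (add_nonneg (hγ.1 k).1 (mul_nonneg (Nat.cast_nonneg _) (hB0 k)))
    (sub_le_iff_le_add'.2 (hwin k))⟩
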